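/- For $f:\mathbb{R}\to\mathbb{R}$ write $\Delta_h f(x)=f(x+h)-f(x)$ and $G(f)=\{(x,f(x)):x\in\mathbb{R}\}\subset\mathbb{R}^2$. For an integer $n\ge 0$, $f$ is called an $n$-monomial function if $$\frac{1}{n!}\,\Delta_h^n f(x)=f(h)\qquad\text{for all }x,h\in\mathbb{R}.$$ **Theorem (dichotomy for monomial functions).** 1. If $f:\mathbb{R}\to\mathbb{R}$ is an $n$-monomial function for some $n\ge 0$, then $G(f)$ is either connected or totally disconnected (and not both). 2. For every integer $n\ge 1$ both cases occur for discontinuous $n$-monomial functions: there is a discontinuous $n$-monomial function with totally disconnected graph, and there is one with connected graph. Concretely: (a) There is a Hamel basis $\gamma$ of $\mathbb{R}$ over $\mathbb{Q}$ with $1\in\gamma$. For every such $\gamma$ there is a unique $\mathbb{Q}$-linear map $A_\gamma:\mathbb{R}\to\mathbb{R}$ with $A_\gamma(1)=1$ and $A_\gamma(b)=0$ for all $b\in\gamma\setminus\{1\}$; it takes values in $\mathbb{Q}$, and for every $n\ge 1$ the function $x\mapsto A_\gamma(x)^n$ is a discontinuous $n$-monomial function with totally disconnected graph. (b) (Jones)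 There is a discontinuous additive function $g:\mathbb{R}\to\mathbb{R}$ with connected graph. For every such $g$ and every $n\ge 1$, the function $x\mapsto x^{n-1}g(x)$ is a discontinuous $n$-monomial function with connected graph. -/

import Mathlib

open scoped Nat

/-- `f : ℝ → ℝ` is an `n`-monomial if it solves the monomial functional equation
`(1 / n!) * Δ_h^n f (x) = f h` for all real `x`, `h`, where `Δ_h f (x) = f (x + h) - f x`
(`fwdDiff h f x`) and `Δ_h^n` is the `n`-th iterate of `Δ_h`. -/
def IsMonomialFun (n : ℕ) (f : ℝ → ℝ) : Prop :=
  ∀ x h : ℝ, (1 / (n ! : ℝ)) * (fwdDiff h)^[n] f x = f h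

/-- The graph `G(f) = {(x, f x) : x ∈ ℝ}`, a subset of the plane. -/
def graphSet (f : ℝ → ℝ) : Set (ℝ × ℝ) :=
  {p | p.2 = f p.1}

/-- A Hamel basis: a set of reals that is a basis of `ℝ` as a vector space over `ℚ`. -/
def IsHamelBasis (γ : Set ℝ) : Prop :=
  LinearIndepOn ℚ id γ ∧ Submodule.span ℚ γ = ⊤

/-- The defining property of the map `A_γ`: the `ℚ`-linear map `A` satisfies `A 1 = 1` and
vanishes on all elements of `γ` other than `1`. -/
def IsUnitCoordinate (γ : Set ℝ) (A : ℝ →ₗ[ℚ] ℝ) : Prop :=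
  A 1 = 1 ∧ ∀ b ∈ γ, b ≠ 1 → A b = 0

/-! An `n`-monomial satisfies `f (q x) = q ^ n * f x` for rational `q`, so its graph is invariant
under the maps `(x, y) ↦ (q x, q ^ n y)`. A connected piece of the graph with two points covers an
interval; for `n ≥ 1` its rational rescalings overlap along a half-line, the origin is a limit of
that part, and `q = -1` gives the other half (`isConnected_graphSet_of_interval`).

Totally disconnected examples: `A_γ` has countable range, so `A_γ ^ n` is constant on connected
pieces of its graph, yet it is constant on no interval. Connected examples: transfinite recursion
gives an additive `g` whose graph meets every closed planar set with uncountable projection, which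
forces connectedness; the graph of `x ^ (n - 1) * g x` is a continuous image of that of `g`. -/

/-! ### Rational homogeneity and products of additive functions -/

section Monomial

/-- A constant difference of order `n + 1` makes the `n`-th difference affine along multiples of
`h`. Hence the `n`-th `h`-difference of `Δ_{mh} f` is the constant `m • c`, and induction applies to
it. -/
lemma fwdDiff_iter_zsmul_of_const {M G : Type*} [AddCommGroup M] [AddCommGroup G] (h : M) (m : ℤ) :
    ∀ (n : ℕ) (f : M → G) (c : G), (∀ x, (fwdDiff h)^[n] f x = c) →
      ∀ x, (fwdDiff (m • h))^[n] f x = m ^ n • c := by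
  intro n
  induction n with
  | zero => intro f c hf x; simpa using hf x
  | succ n ih =>
    intro f c hf x
    have hstep : ∀ (k : ℤ) x, (fwdDiff h)^[n] f (x + k • h) = (fwdDiff h)^[n] f x + k • c := by
      have h1 : ∀ x, (fwdDiff h)^[n] f (x + h) = (fwdDiff h)^[n] f x + c := by
        intro x
        have := hf x
        rw [Function.iterate_succ_apply'] at this
        rw [← this, fwdDiff]; abel
      intro k
      induction k with
      | zero => simp
      | succ i hi =>
        intro x
        rw [add_smul, one_smul, ← add_assoc, h1, hi, add_smul, one_smul, add_assoc]
      | pred i hi =>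
        intro x
        have := h1 (x + (-(i : ℤ) - 1) • h)
        rw [sub_smul, one_smul, ← add_sub_assoc, sub_add_cancel, hi] at this
        rw [sub_smul, one_smul, ← add_sub_assoc, sub_smul, one_smul, ← add_sub_assoc, this]
        abel
    rw [Function.iterate_succ_apply]
    rw [ih (fwdDiff (m • h) f) (m • c) ?_ x, pow_succ, mul_smul]
    intro y
    have : fwdDiff (m • h) f = (fun z => f (z + m • h)) - f := rfl
    rw [this, sub_eq_add_neg, ← neg_one_smul ℤ f, fwdDiff_iter_add, fwdDiff_iter_const_smul]
    simp only [Pi.add_apply, Pi.smul_apply]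
    rw [fwdDiff_iter_comp_add, hstep]
    simp

lemma IsMonomialFun.fwdDiff_iter {n : ℕ} {f : ℝ → ℝ} (hf : IsMonomialFun n f) (h x : ℝ) :
    (fwdDiff h)^[n] f x = n ! * f h := by
  rw [← hf x h]
  have : (n ! : ℝ) ≠ 0 := by positivity
  field_simp

lemma IsMonomialFun.map_int_mul {n : ℕ} {f : ℝ → ℝ} (hf : IsMonomialFun n f) (m : ℤ) (x : ℝ) :
    f (m * x) = m ^ n * f x := by
  have h1 := fwdDiff_iter_zsmul_of_const x m n f _ (hf.fwdDiff_iter x) 0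
  rw [hf.fwdDiff_iter, zsmul_eq_mul, zsmul_eq_mul] at h1
  have : (n ! : ℝ) ≠ 0 := by positivity
  apply mul_left_cancel₀ this
  rw [h1]; push_cast; ring

lemma IsMonomialFun.map_rat_mul {n : ℕ} {f : ℝ → ℝ} (hf : IsMonomialFun n f) (q : ℚ) (x : ℝ) :
    f (q * x) = q ^ n * f x := by
  have hd : (q.den : ℝ) ≠ 0 := by exact_mod_cast q.den_ne_zero
  have h1 := hf.map_int_mul q.den (q * x)
  have h2 := hf.map_int_mul q.num x
  have h3 : ((q.den : ℤ) : ℝ) * (q * x) = (q.num : ℝ) * x := by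
    rw [← mul_assoc]; congr 1
    have := Rat.den_mul_eq_num q
    exact_mod_cast this
  rw [h3, h2] at h1
  have h4 : (q : ℝ) = q.num / q.den := by exact_mod_cast (Rat.num_div_den q).symm
  push_cast at h1
  have h5 : (q : ℝ) ^ n = q.num ^ n / q.den ^ n := by rw [← div_pow, ← h4]
  rw [h5, div_mul_eq_mul_div, h1]
  field_simp

open Polynomial in
lemma Polynomial.fwdDiff_iter_eval_of_natDegree_le {R : Type*} [CommRing R] {P : R[X]} {n : ℕ}
    (hP : P.natDegree ≤ n) (x : R) : (fwdDiff 1)^[n] P.eval x = n ! * P.coeff n := by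
  rcases hP.eq_or_lt with rfl | hlt
  · rw [P.fwdDiff_iter_degree_eq_factorial]
    simp [mul_comm]
  · rw [Polynomial.fwdDiff_iter_eq_zero_of_degree_lt hlt,
      Polynomial.coeff_eq_zero_of_natDegree_lt hlt]
    simp

open Polynomial in
-- At the points `x + k h`, `k ∈ ℕ`, the function takes the values at `k` of a polynomial of degree
-- at most `m + 1`, whose coefficient in that degree is `a h ^ m * g h`.
lemma isMonomialFun_pow_mul (a g : ℝ →+ ℝ) (m : ℕ) :
    IsMonomialFun (m + 1) (fun x => a x ^ m * g x) := by
  intro x h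
  set P : ℝ[X] := (C (a h) * X + C (a x)) ^ m * (C (g h) * X + C (g x)) with hPdef
  have hd1 : (C (a h) * X + C (a x)).natDegree ≤ 1 := natDegree_linear_le
  have hd2 : (C (g h) * X + C (g x)).natDegree ≤ 1 := natDegree_linear_le
  have hd3 : ((C (a h) * X + C (a x)) ^ m).natDegree ≤ m := by
    simpa using natDegree_pow_le_of_le m hd1
  have hP : P.natDegree ≤ m + 1 := natDegree_mul_le_of_le hd3 hd2
  have hc : P.coeff (m + 1) = a h ^ m * g h := by
    rw [hPdef, coeff_mul_add_eq_of_natDegree_le hd3 hd2]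
    have := coeff_pow_of_natDegree_le (m := m) hd1
    rw [mul_one] at this
    rw [this]; simp
  have key := Polynomial.fwdDiff_iter_eval_of_natDegree_le hP 0
  have heq : (fwdDiff h)^[m + 1] (fun x => a x ^ m * g x) x = (fwdDiff 1)^[m + 1] P.eval 0 := by
    rw [fwdDiff_iter_eq_sum_shift, fwdDiff_iter_eq_sum_shift]
    refine Finset.sum_congr rfl fun k _ => ?_
    congr 1
    simp only [hPdef, eval_mul, eval_pow, eval_add, eval_C, eval_X, map_add, map_nsmul]
    simp only [nsmul_eq_mul]
    ring
  rw [heq, key, hc]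
  have : ((m + 1)! : ℝ) ≠ 0 := by positivity
  field_simp

end Monomial

/-! ### The dichotomy -/

section Graph

lemma graphSet_eq_range (f : ℝ → ℝ) : graphSet f = Set.range fun x => (x, f x) := by
  ext ⟨x, y⟩
  simp only [graphSet, Set.mem_ofPred_eq, Set.mem_range, Prod.mk.injEq]
  constructor
  · intro h; exact ⟨x, rfl, h.symm⟩
  · rintro ⟨z, rfl, h⟩; exact h.symm

lemma mem_graphSet (f : ℝ → ℝ) (x : ℝ) : (x, f x) ∈ graphSet f := rfl

/-- Connected and totally disconnected exclude each other for graphs of real functions. -/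
lemma not_isTotallyDisconnected_graphSet {f : ℝ → ℝ} (hc : IsConnected (graphSet f)) :
    ¬ IsTotallyDisconnected (graphSet f) := by
  intro ht
  have := ht _ subset_rfl hc.isPreconnected (mem_graphSet f 0) (mem_graphSet f 1)
  simp at this

lemma isConnected_graphSet_of_continuous {f : ℝ → ℝ} (hf : Continuous f) :
    IsConnected (graphSet f) := by
  rw [graphSet_eq_range]
  exact isConnected_range (by fun_prop)

lemma isPreconnected_image_scale {n : ℕ}
    {t : Set (ℝ × ℝ)} (ht : IsPreconnected t) (q : ℚ) :
    IsPreconnected ((fun p : ℝ × ℝ => ((q : ℝ) * p.1, (q : ℝ) ^ n * p.2)) '' t) :=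
  ht.image _ (by fun_prop)

lemma image_scale_subset_graphSet {f : ℝ → ℝ} {n : ℕ}
    (hf : ∀ (q : ℚ) (x : ℝ), f (q * x) = q ^ n * f x) {t : Set (ℝ × ℝ)} (ht : t ⊆ graphSet f)
    (q : ℚ) :
    (fun p : ℝ × ℝ => ((q : ℝ) * p.1, (q : ℝ) ^ n * p.2)) '' t ⊆ graphSet f := by
  rintro _ ⟨p, hp, rfl⟩
  have : p.2 = f p.1 := ht hp
  simp [graphSet, hf, this]

/-- If the graph of a rationally homogeneous function has a connected part over a nondegenerate
interval of positive numbers, it is connected. -/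
lemma isConnected_graphSet_of_interval {f : ℝ → ℝ} {n : ℕ} (hn : n ≠ 0)
    (hf : ∀ (q : ℚ) (x : ℝ), f (q * x) = q ^ n * f x) {t : Set (ℝ × ℝ)}
    (htG : t ⊆ graphSet f) (ht : IsPreconnected t) {u v : ℝ} (hu : 0 < u) (huv : u < v)
    (hsub : ∀ x ∈ Set.Ioo u v, (x, f x) ∈ t) : IsConnected (graphSet f) := by
  have hf0 : f 0 = 0 := by
    have := hf 0 0
    simpa [hn] using this
  have hv : 0 < v := hu.trans huv
  have hrel : ∀ x ∈ Set.Ioi (0 : ℝ), ∀ y ∈ Set.Ioi (0 : ℝ),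
      connectedComponentIn (graphSet f) (x, f x) = connectedComponentIn (graphSet f) (y, f y) := by
    intro x hx y hy
    -- The component of `(x, f x)` is locally constant in `x > 0`, hence constant.
    refine isPreconnected_Ioi.induction₂ (s := Set.Ioi (0 : ℝ))
      (fun x y => connectedComponentIn (graphSet f) (x, f x) =
        connectedComponentIn (graphSet f) (y, f y)) ?_
      (fun _ _ _ _ _ _ h1 h2 => h1.trans h2) (fun _ _ _ _ h => h.symm) hx hy
    intro x hx
    have hx : 0 < x := hx
    -- With `x / v < q < x / u`, the rescaled interval `(q u, q v)` contains `x`.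
    obtain ⟨q, hq1, hq2⟩ := exists_rat_btwn (div_lt_div_of_pos_left hx hu huv)
    have hq : (0 : ℝ) < q := (div_pos hx hv).trans hq1
    rw [div_lt_iff₀ hv] at hq1
    rw [lt_div_iff₀ hu] at hq2
    have hmem : ∀ y, q * u < y → y < q * v → (y, f y) ∈
        (fun p : ℝ × ℝ => ((q : ℝ) * p.1, (q : ℝ) ^ n * p.2)) '' t := by
      intro y h1 h2
      have hy : (q : ℝ) * (y / q) = y := by field_simp
      refine ⟨(y / q, f (y / q)), hsub _ ⟨?_, ?_⟩, ?_⟩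
      · rw [lt_div_iff₀ hq]; linarith
      · rw [div_lt_iff₀ hq]; linarith
      · simp only [← hf, hy]
    have hev : ∀ᶠ y in nhdsWithin x (Set.Ioi 0), y ∈ Set.Ioo ((q : ℝ) * u) (q * v) :=
      nhdsWithin_le_nhds (Ioo_mem_nhds hq2 hq1)
    filter_upwards [hev] with y hy
    exact connectedComponentIn_eq ((isPreconnected_image_scale ht q).subset_connectedComponentIn
      (hmem x hq2 hq1) (image_scale_subset_graphSet hf htG q) (hmem y hy.1 hy.2))
  set K := connectedComponentIn (graphSet f) (1, f 1) with hK
  have hKG : K ⊆ graphSet f := connectedComponentIn_subset _ _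
  have hKc : IsPreconnected K := isPreconnected_connectedComponentIn
  have hpos : ∀ x : ℝ, 0 < x → (x, f x) ∈ K := by
    intro x hx
    rw [hK, hrel 1 (by simp) x hx]
    exact mem_connectedComponentIn (mem_graphSet f x)
  have hzero : ((0 : ℝ), (0 : ℝ)) ∈ K := by
    -- The graph points over `1 / (k + 1)` tend to the origin because `n ≠ 0`.
    have hcl : ((0 : ℝ), (0 : ℝ)) ∈ closure K := by
      have hlim : Filter.Tendsto (fun k : ℕ => (1 : ℝ) / ((k : ℝ) + 1)) Filter.atTop (nhds 0) :=
        tendsto_one_div_add_atTop_nhds_zero_nat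
      have hlim2 : Filter.Tendsto
          (fun k : ℕ => ((1 : ℝ) / ((k : ℝ) + 1), ((1 : ℝ) / ((k : ℝ) + 1)) ^ n * f 1))
          Filter.atTop (nhds (0, 0)) := by
        have := hlim.prodMk_nhds ((hlim.pow n).mul_const (f 1))
        simpa [hn] using this
      refine mem_closure_of_tendsto hlim2 (Filter.Eventually.of_forall fun k => ?_)
      have hk : (0 : ℝ) < 1 / ((k : ℝ) + 1) := by positivity
      have h1 := hf (1 / ((k : ℚ) + 1)) 1
      push_cast at h1
      rw [mul_one] at h1
      rw [← h1]
      exact hpos _ hk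
    have hins : IsPreconnected (insert ((0 : ℝ), (0 : ℝ)) K) :=
      hKc.subset_closure (Set.subset_insert _ _)
        (Set.insert_subset hcl subset_closure)
    exact hins.subset_connectedComponentIn (Set.mem_insert_of_mem _ (hpos 1 one_pos))
      (Set.insert_subset (by simp [graphSet, hf0]) hKG) (Set.mem_insert _ _)
  have hneg : ∀ x : ℝ, x < 0 → (x, f x) ∈ K := by
    intro x hx
    have hKz : connectedComponentIn (graphSet f) ((0 : ℝ), (0 : ℝ)) = K :=
      (connectedComponentIn_eq hzero).symm
    rw [← hKz]
    refine (isPreconnected_image_scale (n := n) hKc (-1)).subset_connectedComponentIn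
      ⟨_, hzero, by simp⟩ (image_scale_subset_graphSet hf hKG (-1))
      ⟨_, hpos (-x) (by linarith), ?_⟩
    simp only [← hf]; simp
  have : graphSet f = K := by
    refine Set.Subset.antisymm ?_ hKG
    rintro ⟨x, y⟩ (rfl : y = f x)
    rcases lt_trichotomy x 0 with h | rfl | h
    · exact hneg x h
    · rw [hf0]; exact hzero
    · exact hpos x h
  rw [this]
  exact ⟨⟨_, hzero⟩, hKc⟩

lemma isConnected_graphSet_of_not_isTotallyDisconnected {f : ℝ → ℝ} {n : ℕ} (hn : n ≠ 0)
    (hf : ∀ (q : ℚ) (x : ℝ), f (q * x) = q ^ n * f x)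
    (h : ¬ IsTotallyDisconnected (graphSet f)) : IsConnected (graphSet f) := by
  simp only [IsTotallyDisconnected, not_forall, Set.not_subsingleton_iff] at h
  obtain ⟨t, htG, ht, ⟨a, fa⟩, ha, ⟨b, fb⟩, hb, hab⟩ := h
  have hfa : fa = f a := htG ha
  have hfb : fb = f b := htG hb
  subst hfa hfb
  wlog hlt : a < b generalizing a b
  · refine this b a hb ha hab.symm (lt_of_le_of_ne (not_lt.1 hlt) ?_)
    rintro rfl; exact hab rfl
  have hfst : ∀ x ∈ Set.Icc a b, (x, f x) ∈ t := by
    intro x hx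
    have hi : IsPreconnected (Prod.fst '' t) := ht.image _ continuous_fst.continuousOn
    obtain ⟨⟨x', y⟩, hp, rfl⟩ := hi.Icc_subset ⟨_, ha, rfl⟩ ⟨_, hb, rfl⟩ hx
    have : y = f x' := htG hp
    rwa [this] at hp
  -- Midpoints serve as left endpoints to keep `u` strictly positive; if `b ≤ 0`, the piece is first
  -- reflected by `q = -1`.
  rcases lt_or_ge 0 b with hb0 | hb0
  · have hm : max a 0 < b := max_lt hlt hb0
    refine isConnected_graphSet_of_interval (u := (max a 0 + b) / 2) (v := b) hn hf htG ht ?_ ?_ ?_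
    · have := le_max_right a 0; linarith
    · linarith
    · intro x hx
      have := le_max_left a 0
      exact hfst x ⟨by linarith [hx.1], hx.2.le⟩
  · refine isConnected_graphSet_of_interval (u := (-a - b) / 2) (v := -a) hn hf
      (image_scale_subset_graphSet hf htG (-1)) (isPreconnected_image_scale (n := n) ht (-1)) ?_ ?_ ?_
    · linarith
    · linarith
    · intro x hx
      refine ⟨_, hfst (-x) ⟨by linarith [hx.2], by linarith [hx.1]⟩, ?_⟩
      simp only [← hf]; simp

lemma IsMonomialFun.xor_isConnected_isTotallyDisconnected {n : ℕ} {f : ℝ → ℝ}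
    (hf : IsMonomialFun n f) :
    Xor (IsConnected (graphSet f)) (IsTotallyDisconnected (graphSet f)) := by
  by_cases hc : IsConnected (graphSet f)
  · exact Or.inl ⟨hc, not_isTotallyDisconnected_graphSet hc⟩
  · refine Or.inr ⟨?_, hc⟩
    by_contra ht
    rcases Nat.eq_zero_or_pos n with rfl | hn
    · refine hc (isConnected_graphSet_of_continuous ?_)
      have : f = fun _ => f 0 := by
        funext x
        simpa using hf x 0
      rw [this]; exact continuous_const
    · exact hc (isConnected_graphSet_of_not_isTotallyDisconnected hn.ne' hf.map_rat_mul ht)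

end Graph

/-! ### Totally disconnected examples -/

section HamelBasis

lemma exists_isHamelBasis_one_mem : ∃ γ : Set ℝ, IsHamelBasis γ ∧ (1 : ℝ) ∈ γ := by
  have h1 : LinearIndepOn ℚ id ({1} : Set ℝ) := LinearIndepOn.singleton one_ne_zero
  obtain ⟨γ, -, hsub, hspan, hli⟩ := exists_linearIndepOn_id_extension h1 (Set.subset_univ _)
  refine ⟨γ, ⟨hli, ?_⟩, hsub rfl⟩
  exact top_unique fun x _ => hspan (Set.mem_univ x)

lemma existsUnique_isUnitCoordinate {γ : Set ℝ} (hγ : IsHamelBasis γ) (h1 : (1 : ℝ) ∈ γ) :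
    ∃! A : ℝ →ₗ[ℚ] ℝ, IsUnitCoordinate γ A := by
  classical
  let B : Module.Basis γ ℚ ℝ := Module.Basis.mk (v := fun x : γ => (x : ℝ)) hγ.1 (by
    rw [Subtype.range_coe, hγ.2])
  have hB : ∀ b : γ, B b = (b : ℝ) := fun b => Module.Basis.mk_apply _ _ b
  refine ⟨B.constr ℚ fun b : γ => if (b : ℝ) = 1 then 1 else 0, ⟨?_, fun b hb hb1 => ?_⟩, ?_⟩
  · have := B.constr_basis ℚ (fun b : γ => if (b : ℝ) = 1 then (1 : ℝ) else 0) ⟨1, h1⟩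
    rw [hB] at this
    simpa using this
  · have := B.constr_basis ℚ (fun b : γ => if (b : ℝ) = 1 then (1 : ℝ) else 0) ⟨b, hb⟩
    rw [hB] at this
    simpa [hb1] using this
  · intro A hA
    refine B.ext fun b => ?_
    rw [B.constr_basis, hB]
    split_ifs with h
    · rw [h, hA.1]
    · exact hA.2 b b.2 h

lemma IsUnitCoordinate.range_subset {γ : Set ℝ} (hγ : IsHamelBasis γ) {A : ℝ →ₗ[ℚ] ℝ}
    (hA : IsUnitCoordinate γ A) : Set.range A ⊆ Set.range (fun q : ℚ => (q : ℝ)) := by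
  rintro _ ⟨x, rfl⟩
  have hx : x ∈ Submodule.span ℚ γ := by rw [hγ.2]; trivial
  induction hx using Submodule.span_induction with
  | mem x hx =>
    by_cases h : x = 1
    · exact ⟨1, by rw [h, hA.1]; simp⟩
    · exact ⟨0, by rw [hA.2 x hx h]; simp⟩
  | zero => exact ⟨0, by simp⟩
  | add x y _ _ hx hy =>
    obtain ⟨p, hp⟩ := hx
    obtain ⟨q, hq⟩ := hy
    exact ⟨p + q, by simp only at hp hq ⊢; rw [map_add, ← hp, ← hq]; push_cast; rfl⟩
  | smul r x _ hx =>
    obtain ⟨p, hp⟩ := hx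
    exact ⟨r * p, by
      simp only at hp ⊢
      rw [map_smul, ← hp, Rat.smul_def]; push_cast; rfl⟩

lemma isMonomialFun_pow (A : ℝ →+ ℝ) {n : ℕ} (hn : 1 ≤ n) :
    IsMonomialFun n (fun x => A x ^ n) := by
  obtain ⟨m, rfl⟩ := Nat.exists_eq_add_of_le' hn
  simpa only [pow_succ] using isMonomialFun_pow_mul A A m

lemma isTotallyDisconnected_graphSet_pow {A : ℝ →ₗ[ℚ] ℝ} (h1 : A 1 = 1)
    (hA : Set.range A ⊆ Set.range (fun q : ℚ => (q : ℝ))) {n : ℕ} (hn : 1 ≤ n) :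
    IsTotallyDisconnected (graphSet (fun x => A x ^ n)) := by
  intro t htG ht
  have hcount : (Set.range fun x => A x ^ n).Countable := by
    refine (((Set.countable_range fun q : ℚ => (q : ℝ)).mono hA).image (· ^ n)).mono ?_
    rintro _ ⟨x, rfl⟩
    exact ⟨A x, ⟨x, rfl⟩, rfl⟩
  have hsnd : (Prod.snd '' t).Subsingleton := by
    refine hcount.isTotallyDisconnected _ ?_ (ht.image _ continuous_snd.continuousOn)
    rintro _ ⟨p, hp, rfl⟩
    exact ⟨p.1, (htG hp).symm⟩
  have hconst : ∀ p ∈ t, ∀ q ∈ t, A p.1 ^ n = A q.1 ^ n := by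
    intro p hp q hq
    have h := hsnd ⟨p, hp, rfl⟩ ⟨q, hq, rfl⟩
    have hp' : p.2 = A p.1 ^ n := htG hp
    have hq' : q.2 = A q.1 ^ n := htG hq
    rw [← hp', ← hq', h]
  have hi : IsPreconnected (Prod.fst '' t) := ht.image _ continuous_fst.continuousOn
  have hle : ∀ p ∈ t, ∀ q ∈ t, ¬ p.1 < q.1 := by
    intro p hp q hq hpq
    -- Even `n` loses the sign, so one increment is not enough: `|A + r| = |A|` gives `A = -r / 2`,
    -- while `|A + 2 r| = |A|` gives `A = -r`.
    obtain ⟨r, hr0, hr⟩ := exists_rat_btwn (show (0 : ℝ) < (q.1 - p.1) / 2 by linarith)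
    have hmem : ∀ s : ℚ, (0 : ℝ) ≤ s → (s : ℝ) ≤ q.1 - p.1 → (A p.1 + s) ^ n = A p.1 ^ n := by
      intro s hs hs'
      obtain ⟨w, hw, hw1⟩ := hi.Icc_subset ⟨p, hp, rfl⟩ ⟨q, hq, rfl⟩
        (show p.1 + (s : ℝ) ∈ Set.Icc p.1 q.1 from ⟨by linarith, by linarith⟩)
      have hAs : A (p.1 + (s : ℝ)) = A p.1 + s := by
        have : (s : ℝ) = s • (1 : ℝ) := by simp [Rat.smul_def]
        rw [map_add, this, map_smul, h1]
      rw [← hAs, ← hw1, hconst w hw p hp]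
    have e1 := hmem r hr0.le (by linarith)
    have e2 := hmem (2 * r) (by push_cast; linarith) (by push_cast; linarith)
    have habs : ∀ a b : ℝ, a ^ n = b ^ n → |a| = |b| := by
      intro a b hab
      refine (pow_left_inj₀ (abs_nonneg a) (abs_nonneg b) (by omega : n ≠ 0)).1 ?_
      rw [← abs_pow, ← abs_pow, hab]
    have e3 := habs _ _ e1
    have e4 := habs _ _ e2
    push_cast at e4
    rcases abs_eq_abs.1 e3 with h | h <;> rcases abs_eq_abs.1 e4 with h' | h' <;> linarith
  intro p hp q hq
  have hpq : p.1 = q.1 := le_antisymm (not_lt.1 (hle q hq p hp)) (not_lt.1 (hle p hp q hq))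
  refine Prod.ext hpq ?_
  exact hsnd ⟨p, hp, rfl⟩ ⟨q, hq, rfl⟩

lemma not_continuous_of_isTotallyDisconnected_graphSet {f : ℝ → ℝ}
    (h : IsTotallyDisconnected (graphSet f)) : ¬ Continuous f := fun hf =>
  not_isTotallyDisconnected_graphSet (isConnected_graphSet_of_continuous hf) h

end HamelBasis

/-! ### Connected examples from an additive function -/

section ConnectedExample

lemma isMonomialFun_pow_sub_one_mul (g : ℝ →+ ℝ) {n : ℕ} (hn : 1 ≤ n) :
    IsMonomialFun n (fun x => x ^ (n - 1) * g x) := by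
  obtain ⟨m, rfl⟩ := Nat.exists_eq_add_of_le' hn
  simpa using isMonomialFun_pow_mul (AddMonoidHom.id ℝ) g m

lemma isConnected_graphSet_pow_mul {g : ℝ → ℝ} (hg : IsConnected (graphSet g)) (m : ℕ) :
    IsConnected (graphSet fun x => x ^ m * g x) := by
  have : graphSet (fun x => x ^ m * g x) =
      (fun p : ℝ × ℝ => (p.1, p.1 ^ m * p.2)) '' graphSet g := by
    rw [graphSet_eq_range, graphSet_eq_range, ← Set.range_comp]
    rfl
  rw [this]
  exact hg.image _ (by fun_prop)

/-- Dividing by `x ^ m` near `1` would make `g` continuous at a point, hence everywhere by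
additivity. -/
lemma not_continuous_pow_mul {g : ℝ →+ ℝ} (hg : ¬ Continuous g) (m : ℕ) :
    ¬ Continuous fun x => x ^ m * g x := by
  intro hc
  apply hg
  have h1 : ContinuousAt g 1 := by
    have h2 : ContinuousAt (fun x : ℝ => x ^ m * g x / x ^ m) 1 :=
      hc.continuousAt.div (by fun_prop) (by simp)
    refine h2.congr ?_
    filter_upwards [isOpen_ne.mem_nhds (one_ne_zero : (1 : ℝ) ≠ 0)] with x hx
    have : x ^ m ≠ 0 := pow_ne_zero _ hx
    field_simp
  refine continuous_of_continuousAt_zero g ?_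
  have h3 : ContinuousAt (fun x : ℝ => g (x + 1) - g 1) 0 := by
    refine ContinuousAt.sub ?_ continuousAt_const
    refine ContinuousAt.comp (g := g) (f := fun x : ℝ => x + 1) ?_ (by fun_prop)
    simpa using h1
  simpa using h3

end ConnectedExample

/-! ### Independent transversals by transfinite recursion -/

section Transversal

open Cardinal

lemma Submodule.mk_span_lt_continuum {K V : Type} [Field K] [Countable K] [AddCommGroup V]
    [Module K V] {s : Set V} (hs : #s < 𝔠) : #(Submodule.span K s) < 𝔠 := by
  have hsurj : #(Submodule.span K s) ≤ #((s ⊕ ℕ) →₀ K) := by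
    -- The summand `ℕ`, sent to `0`, only makes the index type infinite for the cardinality formula.
    let v : s ⊕ ℕ → V := Sum.elim (fun x => (x : V)) fun _ => 0
    have hle : Submodule.span K s ≤ LinearMap.range (Finsupp.linearCombination K v) := by
      rw [Finsupp.range_linearCombination, Submodule.span_le]
      intro x hx
      exact Submodule.subset_span ⟨Sum.inl ⟨x, hx⟩, rfl⟩
    exact (mk_le_mk_of_subset hle).trans mk_range_le
  refine hsurj.trans_lt ?_
  rw [mk_finsupp_of_infinite, mk_sum]
  simp only [lift_id]
  refine max_lt (add_lt_of_lt aleph0_le_continuum hs ?_) ?_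
  · simpa using aleph0_lt_continuum
  · exact mk_le_aleph0.trans_lt aleph0_lt_continuum

/-- A nontrivial relation could be solved for the vector of largest index. -/
lemma linearIndependent_of_notMem_span_image_Iio {ι K V : Type*} [LinearOrder ι] [Field K]
    [AddCommGroup V] [Module K V] {v : ι → V}
    (h : ∀ i, v i ∉ Submodule.span K (v '' Set.Iio i)) : LinearIndependent K v := by
  rw [linearIndependent_iff]
  intro l hl
  by_contra hne
  have hsupp : l.support.Nonempty := Finsupp.support_nonempty_iff.2 hne
  set i := l.support.max' hsupp with hi
  have hi_mem : i ∈ l.support := l.support.max'_mem hsupp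
  have hli : l i ≠ 0 := Finsupp.mem_support_iff.1 hi_mem
  apply h i
  have hsum : l i • v i + ∑ j ∈ l.support.erase i, l j • v j = 0 := by
    rw [Finset.add_sum_erase _ (fun j => l j • v j) hi_mem]
    exact hl
  have hv : v i = (l i)⁻¹ • -(∑ j ∈ l.support.erase i, l j • v j) := by
    rw [← eq_neg_of_add_eq_zero_left hsum, smul_smul, inv_mul_cancel₀ hli, one_smul]
  rw [hv]
  refine Submodule.smul_mem _ _ (Submodule.neg_mem _ (Submodule.sum_mem _ fun j hj => ?_))
  refine Submodule.smul_mem _ _ (Submodule.subset_span ⟨j, ?_, rfl⟩)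
  rw [Finset.mem_erase] at hj
  exact lt_of_le_of_ne (l.support.le_max' j hj.2) hj.1

/-- At most continuum many sets of size continuum have a linearly independent transversal. -/
lemma exists_linearIndependent_transversal {ι K V : Type} [Field K] [Countable K] [AddCommGroup V]
    [Module K V] (hι : #ι ≤ 𝔠) (S : ι → Set V) (hS : ∀ i, 𝔠 ≤ #(S i)) :
    ∃ v : ι → V, (∀ i, v i ∈ S i) ∧ LinearIndependent K v := by
  -- In a well-order of minimal type, initial segments have fewer than `𝔠` elements, so the span of
  -- earlier choices cannot contain `S i`.
  obtain ⟨_, _, hord⟩ := exists_ord_eq_type_lt ι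
  have hstep : ∀ (i : ι) (w : Set.Iio i → V),
      ∃ x ∈ S i, x ∉ Submodule.span K (Set.range w) := by
    intro i w
    by_contra! hcon
    have h1 : #(Set.range w) < 𝔠 :=
      mk_range_le.trans_lt ((mk_Iio_lt i hord).trans_le hι)
    exact ((mk_le_mk_of_subset hcon).trans_lt (Submodule.mk_span_lt_continuum h1)).not_ge (hS i)
  choose F hFS hF using hstep
  let v : ι → V := (wellFounded_lt (α := ι)).fix fun i w => F i fun j => w j.1 j.2
  have hv : ∀ i, v i = F i fun j => v j.1 := fun i => WellFounded.fix_eq _ _ _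
  refine ⟨v, fun i => hv i ▸ hFS i _, linearIndependent_of_notMem_span_image_Iio fun i => ?_⟩
  have := hF i fun j => v j.1
  rw [← hv, ← Set.image_eq_range] at this
  exact this

end Transversal

/-! ### Jones' additive function with connected graph -/

section Jones

open Cardinal

/-- Closed planar sets are σ-compact, so some compact piece has uncountable projection, which
contains an injective image of the Cantor space. -/
lemma continuum_le_mk_image_fst {K : Set (ℝ × ℝ)} (hK : IsClosed K)
    (hunc : ¬ (Prod.fst '' K).Countable) : 𝔠 ≤ #(Prod.fst '' K) := by
  have hunion : Prod.fst '' K = ⋃ n : ℕ, Prod.fst '' (K ∩ Metric.closedBall 0 n) := by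
    rw [← Set.image_iUnion, ← Set.inter_iUnion, Metric.iUnion_closedBall_nat, Set.inter_univ]
  have hex : ∃ n : ℕ, ¬ (Prod.fst '' (K ∩ Metric.closedBall 0 n)).Countable := by
    by_contra! hcon
    exact hunc (hunion ▸ Set.countable_iUnion hcon)
  obtain ⟨n, hn⟩ := hex
  have hcomp : IsCompact (Prod.fst '' (K ∩ Metric.closedBall 0 n)) :=
    ((isCompact_closedBall (0 : ℝ × ℝ) (n : ℝ)).inter_left hK).image continuous_fst
  obtain ⟨f, hf, -, hinj⟩ := hcomp.isClosed.exists_nat_bool_injection_of_not_countable hn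
  have h1 : 𝔠 ≤ #(Set.range f) := by
    rw [mk_range_eq f hinj]; simp
  refine h1.trans (mk_le_mk_of_subset (hf.trans ?_))
  exact Set.image_mono Set.inter_subset_left

/-- Closed sets lie in the countably generated Borel σ-algebra, which has at most `𝔠` members. -/
lemma mk_isClosed_le_continuum : #{K : Set (ℝ × ℝ) | IsClosed K} ≤ 𝔠 := by
  obtain ⟨b, hb, hgen⟩ := MeasurableSpace.CountablyGenerated.isCountablyGenerated (α := ℝ × ℝ)
  have h := MeasurableSpace.cardinal_measurableSet_le_continuum (s := b)
    (hb.le_aleph0.trans aleph0_le_continuum)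
  refine (mk_le_mk_of_subset fun K hK => ?_).trans h
  have : MeasurableSet K := IsClosed.measurableSet hK
  rwa [hgen] at this

/-- An additive function whose graph meets every closed planar set with uncountable projection. -/
lemma exists_addMonoidHom_graph_meets_closed : ∃ g : ℝ →+ ℝ, ∀ K : Set (ℝ × ℝ), IsClosed K →
    ¬ (Prod.fst '' K).Countable → (K ∩ graphSet g).Nonempty := by
  let ι := {K : Set (ℝ × ℝ) // IsClosed K ∧ ¬ (Prod.fst '' K).Countable}
  have hι : #ι ≤ 𝔠 :=
    (mk_le_mk_of_subset fun K (hK : IsClosed K ∧ _) => hK.1).trans mk_isClosed_le_continuum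
  obtain ⟨v, hv, hli⟩ := exists_linearIndependent_transversal (K := ℚ) hι
    (fun K => Prod.fst '' K.1) fun K => continuum_le_mk_image_fst K.2.1 K.2.2
  choose p hpK hpv using hv
  -- Independence of the abscissae `v i` lets `g` be prescribed there as the ordinate of the chosen
  -- point `p i` of each closed set.
  obtain ⟨g, hg⟩ := LinearMap.exists_extend
    ((Finsupp.linearCombination ℚ fun i => (p i).2).comp hli.repr)
  refine ⟨g.toAddMonoidHom, fun K hK hunc => ⟨p ⟨K, hK, hunc⟩, hpK ⟨K, hK, hunc⟩, ?_⟩⟩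
  set i : ι := ⟨K, hK, hunc⟩
  have h1 := LinearMap.congr_fun hg ⟨v i, Submodule.subset_span ⟨i, rfl⟩⟩
  rw [LinearMap.comp_apply, LinearMap.comp_apply, hli.repr_eq_single i _ rfl] at h1
  have h2 : g (v i) = (p i).2 := by simpa using h1
  change (p i).2 = g (p i).1
  rw [hpv, h2]

lemma exists_isClosed_subset_not_countable_image_fst {W : Set (ℝ × ℝ)} (hW : IsOpen W) (hne : W.Nonempty) :
    ∃ K ⊆ W, IsClosed K ∧ ¬ (Prod.fst '' K).Countable := by
  obtain ⟨x, hx⟩ := hne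
  obtain ⟨ε, hε, hball⟩ := Metric.nhds_basis_closedBall.mem_iff.1 (hW.mem_nhds hx)
  refine ⟨_, hball, Metric.isClosed_closedBall, fun hc => ?_⟩
  have hsub : Set.Ioo (x.1 - ε) (x.1 + ε) ⊆ Prod.fst '' Metric.closedBall x ε := by
    intro y hy
    refine ⟨(y, x.2), ?_, rfl⟩
    rw [Metric.mem_closedBall, Prod.dist_eq, dist_self, max_eq_left dist_nonneg, Real.dist_eq,
      abs_le]
    constructor <;> linarith [hy.1, hy.2]
  have h1 := (hc.mono hsub).le_aleph0
  rw [mk_Ioo_real (by linarith)] at h1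
  exact h1.not_gt aleph0_lt_continuum

/-- If open `U`, `V` separate the graph, then `U ∩ V` is empty, as it would contain a closed ball
meeting the graph, and the complement of `U ∪ V` has countable projection. So over a dense set of
abscissae each vertical line lies wholly in `U` or in `V`. -/
lemma isConnected_graphSet_of_meets_closed {g : ℝ → ℝ}
    (hg : ∀ K : Set (ℝ × ℝ), IsClosed K → ¬ (Prod.fst '' K).Countable →
      (K ∩ graphSet g).Nonempty) : IsConnected (graphSet g) := by
  refine ⟨⟨_, mem_graphSet g 0⟩, isPreconnected_iff_subset_of_disjoint.2 ?_⟩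
  intro U V hU hV hcov hdisj
  have hUV : U ∩ V = ∅ := by
    by_contra hne
    obtain ⟨K, hKW, hK, hunc⟩ := exists_isClosed_subset_not_countable_image_fst (hU.inter hV)
      (Set.nonempty_iff_ne_empty.2 hne)
    obtain ⟨p, hpK, hpG⟩ := hg K hK hunc
    exact (Set.eq_empty_iff_forall_notMem.1 hdisj) p ⟨hpG, hKW hpK⟩
  have hcount : (Prod.fst '' (U ∪ V)ᶜ).Countable := by
    by_contra hunc
    obtain ⟨p, hp, hpG⟩ := hg _ (hU.union hV).isClosed_compl hunc
    exact hp (hcov hpG)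
  set X : Set ℝ := (Prod.fst '' (U ∪ V)ᶜ)ᶜ with hX
  have hXd : Dense X := hcount.dense_compl ℝ
  have hline : ∀ x ∈ X, ∀ y, (x, y) ∈ U ∪ V := by
    intro x hx y
    by_contra h
    exact hx ⟨(x, y), h, rfl⟩
  have hside : ∀ x ∈ X, ∀ y z, (x, y) ∈ U → (x, z) ∈ U := by
    intro x hx y z hy
    have hpre : IsPreconnected ((fun t : ℝ => (x, t)) '' Set.univ) :=
      isPreconnected_univ.image _ (by fun_prop)
    have hmeet : ((fun t : ℝ => (x, t)) '' Set.univ ∩ U).Nonempty :=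
      ⟨(x, y), ⟨y, trivial, rfl⟩, hy⟩
    have hsub := hpre.subset_left_of_subset_union hU hV (Set.disjoint_iff_inter_eq_empty.2 hUV)
      (by rintro _ ⟨t, -, rfl⟩; exact hline x hx t) hmeet
    exact hsub ⟨z, trivial, rfl⟩
  -- If `(x', g x') ∈ V` for `x'` near `x`, some `t ∈ X` near `x'` has `(t, g x) ∈ U` and `(t, g x')
  -- ∈ V` on one vertical line.
  have hPopen : IsOpen {x | (x, g x) ∈ U} := by
    rw [isOpen_iff_mem_nhds]
    intro x hx
    have hI : IsOpen ((fun t : ℝ => (t, g x)) ⁻¹' U) := hU.preimage (by fun_prop)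
    filter_upwards [hI.mem_nhds hx] with x' hx'
    refine (hcov (mem_graphSet g x')).resolve_right fun hV' => ?_
    have hJ : IsOpen ((fun t : ℝ => (t, g x)) ⁻¹' U ∩ (fun t : ℝ => (t, g x')) ⁻¹' V) :=
      hI.inter (hV.preimage (by fun_prop))
    obtain ⟨t, ⟨htU, htV⟩, htX⟩ := hXd.inter_open_nonempty _ hJ ⟨x', hx', hV'⟩
    exact (Set.eq_empty_iff_forall_notMem.1 hUV) _ ⟨hside t htX _ (g x') htU, htV⟩
  have hQopen : IsOpen {x | (x, g x) ∈ V} := by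
    rw [isOpen_iff_mem_nhds]
    intro x hx
    have hI : IsOpen ((fun t : ℝ => (t, g x)) ⁻¹' V) := hV.preimage (by fun_prop)
    filter_upwards [hI.mem_nhds hx] with x' hx'
    refine (hcov (mem_graphSet g x')).resolve_left fun hU' => ?_
    have hJ : IsOpen ((fun t : ℝ => (t, g x)) ⁻¹' V ∩ (fun t : ℝ => (t, g x')) ⁻¹' U) :=
      hI.inter (hU.preimage (by fun_prop))
    obtain ⟨t, ⟨htV, htU⟩, htX⟩ := hXd.inter_open_nonempty _ hJ ⟨x', hx', hU'⟩
    exact (Set.eq_empty_iff_forall_notMem.1 hUV) _ ⟨hside t htX _ (g x) htU, htV⟩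
  have hR := isPreconnected_iff_subset_of_disjoint.1 (isPreconnected_univ (α := ℝ)) _ _
    hPopen hQopen (fun x _ => hcov (mem_graphSet g x)) (by
      rw [Set.univ_inter, Set.eq_empty_iff_forall_notMem]
      exact fun x hx => (Set.eq_empty_iff_forall_notMem.1 hUV) _ hx)
  refine hR.imp ?_ ?_ <;>
  · rintro h ⟨x, y⟩ (rfl : y = g x)
    exact h (Set.mem_univ x)

lemma not_continuous_of_meets_closed {g : ℝ →+ ℝ}
    (hg : ∀ K : Set (ℝ × ℝ), IsClosed K → ¬ (Prod.fst '' K).Countable →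
      (K ∩ graphSet g).Nonempty) : ¬ Continuous g := by
  intro hc
  have hlin : ∀ x, g x = x * g 1 := fun x => by
    have := map_real_smul g hc x 1
    simpa using this
  -- A continuous `g` has a line as graph, and this parallel line misses it.
  obtain ⟨p, hpK, hpG⟩ := hg {p | p.2 = p.1 * g 1 + 1}
    (isClosed_eq (by fun_prop) (by fun_prop)) (by
      have : Prod.fst '' {p : ℝ × ℝ | p.2 = p.1 * g 1 + 1} = Set.univ :=
        Set.eq_univ_of_forall fun x => ⟨(x, x * g 1 + 1), rfl, rfl⟩
      rw [this]
      exact Set.not_countable_univ)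
  have h1 : p.2 = p.1 * g 1 + 1 := hpK
  have h2 : p.2 = g p.1 := hpG
  rw [hlin] at h2
  linarith

lemma exists_not_continuous_isConnected_graphSet :
    ∃ g : ℝ →+ ℝ, ¬ Continuous g ∧ IsConnected (graphSet g) := by
  obtain ⟨g, hg⟩ := exists_addMonoidHom_graph_meets_closed
  exact ⟨g, not_continuous_of_meets_closed hg, isConnected_graphSet_of_meets_closed hg⟩

end Jones
/-- The graph of a monomial function is either connected or totally disconnected; for every
`n ≥ 1` both cases occur among the discontinuous `n`-monomials, with the concrete examples
`A_γ(x) ^ n` and `x ^ (n - 1) * g x`. -/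
theorem theorem1 :
    -- the dichotomy (the two alternatives exclude each other)
    (∀ (n : ℕ) (f : ℝ → ℝ), IsMonomialFun n f →
      Xor (IsConnected (graphSet f)) (IsTotallyDisconnected (graphSet f))) ∧
    -- both cases are attained by discontinuous monomials of every positive degree
    (∀ n : ℕ, 1 ≤ n →
      (∃ f : ℝ → ℝ, IsMonomialFun n f ∧ ¬ Continuous f ∧ IsTotallyDisconnected (graphSet f)) ∧
      (∃ f : ℝ → ℝ, IsMonomialFun n f ∧ ¬ Continuous f ∧ IsConnected (graphSet f))) ∧
    -- the totally disconnected examples: `A_γ(x) ^ n` for any Hamel basis `γ` containing `1`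
    (∃ γ : Set ℝ, IsHamelBasis γ ∧ (1 : ℝ) ∈ γ) ∧
    (∀ γ : Set ℝ, IsHamelBasis γ → (1 : ℝ) ∈ γ →
      (∃! A : ℝ →ₗ[ℚ] ℝ, IsUnitCoordinate γ A) ∧
      ∀ A : ℝ →ₗ[ℚ] ℝ, IsUnitCoordinate γ A →
        Set.range A ⊆ Set.range (fun q : ℚ => (q : ℝ)) ∧
        ∀ n : ℕ, 1 ≤ n →
          IsMonomialFun n (fun x => A x ^ n) ∧
          ¬ Continuous (fun x => A x ^ n) ∧
          IsTotallyDisconnected (graphSet (fun x => A x ^ n))) ∧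
    -- the connected examples: `x ^ (n - 1) * g x` for any discontinuous additive `g` with
    -- connected graph, and such `g` exist
    (∃ g : ℝ →+ ℝ, ¬ Continuous g ∧ IsConnected (graphSet g)) ∧
    (∀ g : ℝ →+ ℝ, ¬ Continuous g → IsConnected (graphSet g) →
      ∀ n : ℕ, 1 ≤ n →
        IsMonomialFun n (fun x => x ^ (n - 1) * g x) ∧
        ¬ Continuous (fun x => x ^ (n - 1) * g x) ∧
        IsConnected (graphSet (fun x => x ^ (n - 1) * g x))) := by
  refine ⟨fun n f hf => hf.xor_isConnected_isTotallyDisconnected, fun n hn => ⟨?_, ?_⟩,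
    exists_isHamelBasis_one_mem, fun γ hγ h1 => ⟨existsUnique_isUnitCoordinate hγ h1, ?_⟩,
    exists_not_continuous_isConnected_graphSet, fun g hg hconn n hn =>
      ⟨isMonomialFun_pow_sub_one_mul g hn, not_continuous_pow_mul hg _,
        isConnected_graphSet_pow_mul hconn _⟩⟩
  · obtain ⟨γ, hγ, h1⟩ := exists_isHamelBasis_one_mem
    obtain ⟨A, hA, -⟩ := existsUnique_isUnitCoordinate hγ h1
    have htd := isTotallyDisconnected_graphSet_pow hA.1 (hA.range_subset hγ) hn
    exact ⟨_, isMonomialFun_pow A.toAddMonoidHom hn,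
      not_continuous_of_isTotallyDisconnected_graphSet htd, htd⟩
  · obtain ⟨g, hg, hconn⟩ := exists_not_continuous_isConnected_graphSet
    exact ⟨_, isMonomialFun_pow_sub_one_mul g hn, not_continuous_pow_mul hg _,
      isConnected_graphSet_pow_mul hconn _⟩
  · intro A hA
    refine ⟨hA.range_subset hγ, fun n hn => ?_⟩
    have htd := isTotallyDisconnected_graphSet_pow hA.1 (hA.range_subset hγ) hn
    exact ⟨isMonomialFun_pow A.toAddMonoidHom hn,
      not_continuous_of_isTotallyDisconnected_graphSet htd, htd⟩
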